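/- Let $E=\{z\in\mathbb C:|z|<1\}$. For functions $\phi(z)=\sum_{n\ge0}a_nz^n$ and $\psi(z)=\sum_{n\ge0}A_nz^n$ analytic in $E$, let $(\phi*\psi)(z)=\sum_{n\ge0}a_nA_nz^n$; for $h,g,\phi$ analytic in $E$ and $f=h+\overline g$, let $f\,\widetilde*\,\phi=h*\phi+\overline{g*\phi}$. A set $\Omega\subset\mathbb C$ is convex in the direction $e^{i\gamma}$ ($0\le\gamma<\pi$) if every line parallel to the line through $0$ and $e^{i\gamma}$ has connected or empty intersection with $\Omega$. Call $f=h+\overline g$ a normalized harmonic mapping in $E$ if $h,g$ are analytic in $E$ with $h(0)=g(0)=0$ and $h'(0)=1$. Let $K_\gamma$ be the class of univalent analytic functions $F$ in $E$ with $F(0)=0$, $F'(0)=1$ and $F(E)$ convex in the direction $e^{i\gamma}$. Let $K_{H(\gamma)}$ be the class of normalized harmonic mappings $f=h+\overline g$ in $E$ which are univalent and sense-preserving (that is, $h'\ne0$ and $|g'/h'|<1$ in $E$) with $f(E)$ convex in the direction $e^{i\gamma}$. Let $DCP$ be the class of analytic functions $\phi$ in $E$ such that $\phi*F\in K_\gamma$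 for every $\gamma\in[0,\pi)$ and every $F\in K_\gamma$. **Corollary.** Let $\theta\in(0,\pi)$ and let $f_\theta=h_\theta+\overline{g_\theta}$ be a normalized harmonic mapping in $E$ such that $$h_\theta(z)+g_\theta(z)=\frac{1}{2i\sin\theta}\log\left(\frac{1+ze^{i\theta}}{1+ze^{-i\theta}}\right),\qquad z\in E,$$ with the principal branch of the logarithm, and such that $h_\theta'\neq0$ and $|g_\theta'/h_\theta'|<1$ in $E$. Then $f_\theta\,\widetilde*\,\phi\in K_{H(\pi/2)}$ for every $\phi\in DCP$. -/

import Mathlib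

noncomputable section

namespace HarmonicConvolution

/-- The open unit disk `E`. -/
def unitDisk : Set ℂ := Metric.ball (0 : ℂ) 1

/-- The `n`-th Taylor coefficient of `f` at the origin. -/
def taylorCoeff (f : ℂ → ℂ) (n : ℕ) : ℂ := iteratedDeriv n f 0 / (n.factorial : ℂ)

/-- The convolution (Hadamard product) of two functions analytic in the unit disk: the power
series whose coefficients are the products of the Taylor coefficients. For functions analytic in
the unit disk this series converges absolutely at every point of the disk. -/
def hadamard (φ ψ : ℂ → ℂ) (z : ℂ) : ℂ := ∑' n : ℕ, taylorCoeff φ n * taylorCoeff ψ n * z ^ n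

/-- The harmonic function with analytic part `h` and co-analytic part `g`. -/
def harmonicMap (h g : ℂ → ℂ) (z : ℂ) : ℂ := h z + (starRingEnd ℂ) (g z)

/-- The convolution of the harmonic function with analytic part `h` and co-analytic part `g`
with the analytic function `φ`. -/
def harmonicConv (h g φ : ℂ → ℂ) : ℂ → ℂ := harmonicMap (hadamard h φ) (hadamard g φ)

/-- `h` and `g` are the analytic and co-analytic parts of a normalized harmonic mapping
`f(z) = z + ∑_{n ≥ 2} a_n z^n + ∑_{n ≥ 1} conj (b_n z^n)` of the unit disk. -/
structure IsNormalizedPair (h g : ℂ → ℂ) : Prop where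
  analytic_h : DifferentiableOn ℂ h unitDisk
  analytic_g : DifferentiableOn ℂ g unitDisk
  h_zero : h 0 = 0
  g_zero : g 0 = 0
  deriv_h_zero : deriv h 0 = 1

/-- The dilatation `g' / h'` is defined and has modulus less than one throughout the disk. -/
def DilatationLtOne (h g : ℂ → ℂ) : Prop :=
  ∀ z ∈ unitDisk, deriv h z ≠ 0 ∧ ‖deriv g z / deriv h z‖ < 1

/-- `Ω` is convex in the direction `e^{iγ}`: every line parallel to the line through `0` and
`e^{iγ}` has connected or empty intersection with `Ω`. -/
def ConvexInDirection (γ : ℝ) (Ω : Set ℂ) : Prop :=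
  ∀ w : ℂ, IsPreconnected
    (Ω ∩ Set.range fun t : ℝ => w + (t : ℂ) * Complex.exp ((γ : ℂ) * Complex.I))

/-- The class `S` of normalized univalent analytic functions in the unit disk. -/
def classS : Set (ℂ → ℂ) :=
  {f | DifferentiableOn ℂ f unitDisk ∧ f 0 = 0 ∧ deriv f 0 = 1 ∧ Set.InjOn f unitDisk}

/-- The class `S_H` of normalized univalent sense-preserving harmonic mappings of the unit disk.
A univalent harmonic mapping is sense-preserving exactly when its dilatation is less than one in
modulus. -/
def classSH : Set (ℂ → ℂ) :=
  {f | ∃ h g : ℂ → ℂ, IsNormalizedPair h g ∧ DilatationLtOne h g ∧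
    Set.EqOn f (harmonicMap h g) unitDisk ∧ Set.InjOn f unitDisk}

/-- The class `K_γ` of functions in `S` whose image is convex in the direction `e^{iγ}`. -/
def classK (γ : ℝ) : Set (ℂ → ℂ) := {f ∈ classS | ConvexInDirection γ (f '' unitDisk)}

/-- The class `K_{H(γ)}` of functions in `S_H` whose image is convex in the direction `e^{iγ}`. -/
def classKH (γ : ℝ) : Set (ℂ → ℂ) := {f ∈ classSH | ConvexInDirection γ (f '' unitDisk)}

/-- The class `DCP` of direction-convexity-preserving analytic functions. -/
def classDCP : Set (ℂ → ℂ) :=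
  {φ | DifferentiableOn ℂ φ unitDisk ∧
    ∀ γ ∈ Set.Ico (0 : ℝ) Real.pi, ∀ f ∈ classK γ, hadamard φ f ∈ classK γ}

end HarmonicConvolution

end

namespace HarmonicConvolution

open Filter Topology ComplexConjugate

/-! The function `h + g` maps the disk conformally onto a vertical strip. Put `c = -e^{2iγ}`. In the
strip coordinate, the derivative of `h + c g` is `(h' + c g') / (h' + g')`. Multiplied by `e^{-iγ}`,
it has real part `cos γ · (|h'|² - |g'|²) / |h' + g'|²`, which has constant sign unless `cos γ = 0`,
when `c = 1` and the function is the strip coordinate itself. The sign gives univalence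
(`injOn_of_deriv_re_pos`) and convexity in the direction `e^{iγ}` (`isPreconnected_level_im`), so `h
+ c g` lies in `K_γ`. Every unimodular `c` arises in this way.

Let `K = h * φ` and `L = g * φ`. By linearity of the convolution and the definition of `DCP`, every
`K + c L` with `|c| = 1` is univalent, so it has no critical point and `|K'| = |L'|` never occurs.
Since `K'(0) = 1` and `L'(0) = 0`, connectedness of the disk gives `|L'| < |K'|` throughout. For `γ
= π/2` one has `c = 1`: `K + L` is univalent and convex in the vertical direction, and shearing it
(`shear`) yields both properties for the harmonic map with parts `K` and `L`. -/

/-! ### Critical points of injective holomorphic functions -/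

/-- A holomorphic function that is injective near a point has nonzero derivative there. -/
theorem deriv_ne_zero_of_injOn {f : ℂ → ℂ} {U : Set ℂ} {z₀ : ℂ} (hU : U ∈ 𝓝 z₀)
    (hf : AnalyticAt ℂ f z₀) (hinj : Set.InjOn f U) : deriv f z₀ ≠ 0 := by
  have hnc : ¬ ∀ᶠ z in 𝓝 z₀, f z - f z₀ = 0 := by
    intro hc
    have h1 : ∀ᶠ z in 𝓝[≠] z₀, (z ∈ U ∧ f z - f z₀ = 0) ∧ z ≠ z₀ :=
      (((eventually_mem_set.mpr hU).and hc).filter_mono nhdsWithin_le_nhds).and eventually_mem_nhdsWithin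
    obtain ⟨z, ⟨hzU, hz⟩, hne⟩ := h1.exists
    exact hne (hinj hzU (mem_of_mem_nhds hU) (sub_eq_zero.mp hz))
  have hfs : AnalyticAt ℂ (fun z => f z - f z₀) z₀ := hf.sub analyticAt_const
  obtain ⟨n, u, hu, hu0, heq⟩ := hfs.exists_eventuallyEq_pow_smul_nonzero_iff.mpr hnc
  simp only [smul_eq_mul] at heq
  have hn0 : n ≠ 0 := by
    rintro rfl
    have := heq.self_of_nhds
    simp at this
    exact hu0 this.symm
  by_cases hn1 : n = 1
  · subst hn1
    have h2 : HasDerivAt (fun z => (z - z₀) ^ 1 * u z) (u z₀) z₀ := by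
      have := (((hasDerivAt_id z₀).sub_const z₀).pow 1).mul hu.differentiableAt.hasDerivAt
      simpa using! this
    have h3 : HasDerivAt (fun z => f z - f z₀) (u z₀) z₀ := h2.congr_of_eventuallyEq heq
    rw [(by simpa using! h3.add_const (f z₀) : HasDerivAt f (u z₀) z₀).deriv]
    exact hu0
  exfalso
  have hn2 : 1 < n := by omega
  -- A local `n`-th root: `u z / u z₀` is near `1`, so `r` is analytic with `r'(z₀) = 1`, and `f - f
  -- z₀ = u z₀ * r ^ n`. Being locally onto, `r` takes both values `w` and `ζ w` in `U`, and `f`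
  -- agrees at those two points.
  set r : ℂ → ℂ := fun z => (z - z₀) * Complex.exp (Complex.log (u z / u z₀) / n) with hr
  have hone : u z₀ / u z₀ = 1 := div_self hu0
  have hslit : u z₀ / u z₀ ∈ Complex.slitPlane := by rw [hone]; simp
  have han : AnalyticAt ℂ (fun z => Complex.exp (Complex.log (u z / u z₀) / n)) z₀ :=
    (((hu.div analyticAt_const hu0).clog hslit).div analyticAt_const
      (by exact_mod_cast hn0)).cexp
  have hra : AnalyticAt ℂ r z₀ := (analyticAt_id.sub analyticAt_const).mul han
  have hrd : HasDerivAt r 1 z₀ := by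
    have := ((hasDerivAt_id z₀).sub_const z₀).mul han.differentiableAt.hasDerivAt
    simpa [hone] using! this
  have hrs : HasStrictDerivAt r 1 z₀ := by
    have := hra.hasStrictDerivAt
    rwa [hrd.deriv] at this
  have hmap := hrs.map_nhds_eq one_ne_zero
  have hr0 : r z₀ = 0 := by simp [hr]
  rw [hr0] at hmap
  have hune : ∀ᶠ z in 𝓝 z₀, u z ≠ 0 := hu.continuousAt.eventually_ne hu0
  have hP : ∀ᶠ z in 𝓝 z₀, z ∈ U ∧ f z - f z₀ = u z₀ * r z ^ n := by
    filter_upwards [hU, heq, hune] with z hzU hz hzu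
    refine ⟨hzU, ?_⟩
    have hnC : (n : ℂ) ≠ 0 := by exact_mod_cast hn0
    rw [hz, hr]
    simp only
    rw [mul_pow, ← Complex.exp_nat_mul, mul_div_cancel₀ _ hnC,
      Complex.exp_log (div_ne_zero hzu hu0)]
    field_simp
  have hQ : ∀ᶠ w in 𝓝 (0 : ℂ), ∃ z ∈ U, r z = w ∧ f z - f z₀ = u z₀ * w ^ n := by
    rw [← hmap, eventually_map]
    filter_upwards [hP] with z hz
    exact ⟨z, hz.1, rfl, hz.2⟩
  have hζ := Complex.isPrimitiveRoot_exp n hn0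
  set ζ := Complex.exp (2 * Real.pi * Complex.I / n)
  have hcont : Tendsto (fun w : ℂ => ζ * w) (𝓝 0) (𝓝 0) := by
    have : Continuous (fun w : ℂ => ζ * w) := by fun_prop
    simpa using! this.tendsto 0
  have hR : ∀ᶠ w in 𝓝[≠] (0 : ℂ), ((∃ z ∈ U, r z = w ∧ f z - f z₀ = u z₀ * w ^ n) ∧
      (∃ z ∈ U, r z = ζ * w ∧ f z - f z₀ = u z₀ * (ζ * w) ^ n)) ∧ w ≠ 0 :=
    ((hQ.and (hcont.eventually hQ)).filter_mono nhdsWithin_le_nhds).and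
      eventually_mem_nhdsWithin
  obtain ⟨w, ⟨⟨z₁, h1U, h1r, h1⟩, ⟨z₂, h2U, h2r, h2⟩⟩, hw⟩ := hR.exists
  rw [mul_pow, hζ.pow_eq_one, one_mul, ← h1] at h2
  have h12 : z₁ = z₂ := hinj h1U h2U (by linear_combination -h2)
  rw [← h12, h1r] at h2r
  exact hζ.ne_one hn2 (mul_right_cancel₀ hw (by rw [one_mul]; exact h2r.symm))

/-! ### Level sets of `Im G` in a vertical strip -/

/-- The open vertical strip `a < Re w < b`. -/
def verticalStrip (a b : ℝ) : Set ℂ := {w | w.re ∈ Set.Ioo a b}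

theorem isOpen_verticalStrip (a b : ℝ) : IsOpen (verticalStrip a b) :=
  isOpen_Ioo.preimage Complex.continuous_re

theorem convex_verticalStrip (a b : ℝ) : Convex ℝ (verticalStrip a b) :=
  (convex_Ioo a b).linear_preimage Complex.reLm

/-- A maximum principle on a rectangle: the imaginary part of `G` on the horizontal midline is
bounded by its bound `m` on the vertical sides plus a fraction of its bound `M` on the horizontal
sides that decays exponentially with the height of the rectangle. -/
theorem im_le_of_le_on_rectangle {G : ℂ → ℂ} {x₁ x₂ y L m M : ℝ} (hx : x₁ < x₂) (hL : 0 < L)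
    (hG : DifferentiableOn ℂ G (Set.Icc x₁ x₂ ×ℂ Set.univ)) (hmM : m ≤ M)
    (hleft : ∀ t ∈ Set.Icc (y - L) (y + L), (G ⟨x₁, t⟩).im ≤ m)
    (hright : ∀ t ∈ Set.Icc (y - L) (y + L), (G ⟨x₂, t⟩).im ≤ m)
    (hbot : ∀ s ∈ Set.Icc x₁ x₂, (G ⟨s, y - L⟩).im ≤ M)
    (htop : ∀ s ∈ Set.Icc x₁ x₂, (G ⟨s, y + L⟩).im ≤ M)
    {x : ℝ} (hxI : x ∈ Set.Icc x₁ x₂) :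
    (G ⟨x, y⟩).im ≤ m + 2 * (M - m) / Real.cosh (Real.pi / (2 * (x₂ - x₁)) * L) := by
  set k : ℝ := Real.pi / (2 * (x₂ - x₁)) with hk
  have hd : 0 < x₂ - x₁ := sub_pos.mpr hx
  have hkpos : 0 < k := div_pos Real.pi_pos (by linarith)
  -- The barrier `A cos(k(s - xm)) cosh(k(t - y))` is harmonic. Its cosine is at least `1/2` on the
  -- rectangle because `k |s - xm| ≤ π/4`. The factor `2` in `A` compensates for this, making the
  -- barrier at least `M - m` on the horizontal sides.
  set A : ℝ := 2 * (M - m) / Real.cosh (k * L) with hA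
  have hA0 : 0 ≤ A := div_nonneg (by linarith) (Real.cosh_pos _).le
  set xm : ℝ := (x₁ + x₂) / 2 with hxm
  set F : ℂ → ℂ := fun w => Complex.exp (-Complex.I * G w
    - A * Complex.cos (k * (w - (⟨xm, y⟩ : ℂ)))) with hF
  have hnorm : ∀ s t : ℝ, ‖F ⟨s, t⟩‖ = Real.exp ((G ⟨s, t⟩).im
      - A * (Real.cos (k * (s - xm)) * Real.cosh (k * (t - y)))) := by
    intro s t
    rw [hF]
    simp only
    rw [Complex.norm_exp]
    congr 1
    have : ((k : ℂ) * ((⟨s, t⟩ : ℂ) - (⟨xm, y⟩ : ℂ))) =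
        ((k * (s - xm) : ℝ) : ℂ) + ((k * (t - y) : ℝ) : ℂ) * Complex.I := by
      apply Complex.ext <;> simp
    rw [this]
    generalize k * (s - xm) = p
    generalize k * (t - y) = q
    rw [Complex.cos_add_mul_I, ← Complex.ofReal_cos, ← Complex.ofReal_sin,
      ← Complex.ofReal_cosh, ← Complex.ofReal_sinh]
    simp [-Complex.ofReal_cos, -Complex.ofReal_sin, -Complex.ofReal_cosh, -Complex.ofReal_sinh]
  have hcos : ∀ s ∈ Set.Icc x₁ x₂, 1 / 2 ≤ Real.cos (k * (s - xm)) := by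
    intro s hs
    have hb : |k * (s - xm)| ≤ Real.pi / 3 := by
      rw [abs_mul, abs_of_pos hkpos]
      have h1 : |s - xm| ≤ (x₂ - x₁) / 2 := by
        rw [abs_le, hxm]
        constructor <;> linarith [hs.1, hs.2]
      calc k * |s - xm| ≤ k * ((x₂ - x₁) / 2) := by gcongr
        _ = Real.pi / 4 := by rw [hk]; field_simp; norm_num
        _ ≤ Real.pi / 3 := by linarith [Real.pi_pos]
    rw [← Real.cos_abs, ← Real.cos_pi_div_three]
    exact Real.cos_le_cos_of_nonneg_of_le_pi (abs_nonneg _) (by linarith [Real.pi_pos]) hb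
  have hside : ∀ s ∈ Set.Icc x₁ x₂, ∀ t, (G ⟨s, t⟩).im ≤ m → ‖F ⟨s, t⟩‖ ≤ Real.exp m := by
    intro s hs t hst
    rw [hnorm]
    apply Real.exp_le_exp.mpr
    have : 0 ≤ A * (Real.cos (k * (s - xm)) * Real.cosh (k * (t - y))) :=
      mul_nonneg hA0 (mul_nonneg (by linarith [hcos s hs]) (Real.cosh_pos _).le)
    linarith
  have hcap : ∀ s ∈ Set.Icc x₁ x₂, ∀ t, |t - y| = L → (G ⟨s, t⟩).im ≤ M →
      ‖F ⟨s, t⟩‖ ≤ Real.exp m := by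
    intro s hs t ht hst
    rw [hnorm]
    apply Real.exp_le_exp.mpr
    have h1 : Real.cosh (k * (t - y)) = Real.cosh (k * L) := by
      rw [← Real.cosh_abs, abs_mul, abs_of_pos hkpos, ht]
    have h2 : M - m ≤ A * (Real.cos (k * (s - xm)) * Real.cosh (k * (t - y))) := by
      rw [h1]
      calc M - m = A * (1 / 2 * Real.cosh (k * L)) := by
            rw [hA]; field_simp [(Real.cosh_pos (k * L)).ne']
        _ ≤ _ := mul_le_mul_of_nonneg_left
            (mul_le_mul_of_nonneg_right (hcos s hs) (Real.cosh_pos _).le) hA0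
    linarith
  have hdF : DifferentiableOn ℂ F (Set.Icc x₁ x₂ ×ℂ Set.univ) := by
    have : Differentiable ℂ fun w : ℂ => (A : ℂ) * Complex.cos (k * (w - (⟨xm, y⟩ : ℂ))) := by
      fun_prop
    exact ((hG.const_mul _).sub this.differentiableOn).cexp
  have hyL : y - L < y + L := by linarith
  have hcl : closure (Set.Ioo x₁ x₂ ×ℂ Set.Ioo (y - L) (y + L)) =
      Set.Icc x₁ x₂ ×ℂ Set.Icc (y - L) (y + L) := by
    rw [Complex.closure_reProdIm, closure_Ioo hx.ne, closure_Ioo hyL.ne]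
  have hdc : DiffContOnCl ℂ F (Set.Ioo x₁ x₂ ×ℂ Set.Ioo (y - L) (y + L)) := by
    apply DifferentiableOn.diffContOnCl
    rw [hcl]
    exact hdF.mono fun w hw => ⟨hw.1, trivial⟩
  have hxmem : (⟨x, y⟩ : ℂ) ∈ closure (Set.Ioo x₁ x₂ ×ℂ Set.Ioo (y - L) (y + L)) := by
    rw [hcl]
    exact ⟨hxI, ⟨by simp only; linarith, by simp only; linarith⟩⟩
  have hfin := Complex.norm_le_of_forall_mem_frontier_norm_le
    (Bornology.IsBounded.reProdIm (Metric.isBounded_Ioo x₁ x₂)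
      (Metric.isBounded_Ioo (y - L) (y + L))) hdc (C := Real.exp m) (by
      rintro ⟨s, t⟩ hw
      rw [Complex.frontier_reProdIm, closure_Ioo hx.ne, frontier_Ioo hyL, frontier_Ioo hx,
        closure_Ioo hyL.ne] at hw
      rcases hw with ⟨hs, ht⟩ | ⟨hs, ht⟩
      · have hs' : s ∈ Set.Icc x₁ x₂ := hs
        have ht' : t = y - L ∨ t = y + L := ht
        rcases ht' with rfl | rfl
        · exact hcap s hs' _ (by simp [abs_of_pos hL]) (hbot s hs')
        · exact hcap s hs' _ (by simp [abs_of_pos hL]) (htop s hs')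
      · have ht' : t ∈ Set.Icc (y - L) (y + L) := ht
        have hs' : s = x₁ ∨ s = x₂ := hs
        rcases hs' with rfl | rfl
        · exact hside _ ⟨le_rfl, hx.le⟩ t (hleft t ht')
        · exact hside _ ⟨hx.le, le_rfl⟩ t (hright t ht')) hxmem
  rw [hnorm, Real.exp_le_exp, sub_self, mul_zero, Real.cosh_zero, mul_one] at hfin
  have : A * Real.cos (k * (x - xm)) ≤ A * 1 :=
    mul_le_mul_of_nonneg_left (Real.cos_le_one _) hA0
  linarith

/-- If the imaginary part of `G` increases along vertical lines of a strip, then the vertical lines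
on which it takes values below `c` form a strip. -/
theorem exists_im_lt_of_strictMono {G : ℂ → ℂ} {a b c : ℝ}
    (hG : DifferentiableOn ℂ G (verticalStrip a b))
    (hmono : ∀ x ∈ Set.Ioo a b, StrictMono fun y : ℝ => (G ⟨x, y⟩).im)
    {x₁ x x₂ y₁ y₂ : ℝ} (ha : a < x₁) (h1 : x₁ < x) (h2 : x < x₂) (hb : x₂ < b)
    (hy₁ : (G ⟨x₁, y₁⟩).im < c) (hy₂ : (G ⟨x₂, y₂⟩).im < c) :
    ∃ y : ℝ, (G ⟨x, y⟩).im < c := by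
  have hx : x₁ < x₂ := h1.trans h2
  have hsub : Set.Icc x₁ x₂ ×ℂ Set.univ ⊆ verticalStrip a b := fun w hw =>
    ⟨ha.trans_le hw.1.1, hw.1.2.trans_lt hb⟩
  have hI : ∀ s ∈ Set.Icc x₁ x₂, s ∈ Set.Ioo a b := fun s hs =>
    ⟨ha.trans_le hs.1, hs.2.trans_lt hb⟩
  have hm1 := hmono x₁ (hI x₁ ⟨le_rfl, hx.le⟩)
  have hm2 := hmono x₂ (hI x₂ ⟨hx.le, le_rfl⟩)
  set Y := min y₁ y₂
  set m := max (G ⟨x₁, Y⟩).im (G ⟨x₂, Y⟩).im with hm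
  have hmc : m < c := max_lt
    ((hm1.monotone (min_le_left y₁ y₂)).trans_lt hy₁)
    ((hm2.monotone (min_le_right y₁ y₂)).trans_lt hy₂)
  have hcont : ContinuousOn (fun s : ℝ => (G ⟨s, Y⟩).im) (Set.Icc x₁ x₂) := by
    have hc : Continuous fun s : ℝ => (⟨s, Y⟩ : ℂ) := by
      have : (fun s : ℝ => (⟨s, Y⟩ : ℂ)) = fun s : ℝ => (s : ℂ) + (Y : ℂ) * Complex.I := by
        funext s; apply Complex.ext <;> simp
      rw [this]; fun_prop
    exact Complex.continuous_im.comp_continuousOn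
      (hG.continuousOn.comp hc.continuousOn fun s hs => hI s hs)
  obtain ⟨M, hM⟩ := isCompact_Icc.bddAbove_image hcont
  have hMs : ∀ s ∈ Set.Icc x₁ x₂, (G ⟨s, Y⟩).im ≤ M := fun s hs => hM ⟨s, hs, rfl⟩
  have hmM : m ≤ M := max_le (hMs _ ⟨le_rfl, hx.le⟩) (hMs _ ⟨hx.le, le_rfl⟩)
  set k : ℝ := Real.pi / (2 * (x₂ - x₁)) with hk
  have hkpos : 0 < k := div_pos Real.pi_pos (by linarith)
  -- Chosen so that `2 (M - m) < (c - m) T`; with `T ≤ cosh T` the error in the rectangle estimate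
  -- drops below `c - m`.
  set T : ℝ := 2 * (M - m) / (c - m) + 1 with hT
  have hTpos : 0 < T := by
    have : 0 ≤ 2 * (M - m) / (c - m) := div_nonneg (by linarith) (by linarith)
    linarith
  set L : ℝ := T / k
  have hL : 0 < L := div_pos hTpos hkpos
  have hkL : k * L = T := mul_div_cancel₀ _ hkpos.ne'
  -- The rectangle has its top edge at height `Y`; by monotonicity the bounds at height `Y` control
  -- its sides and bottom too.
  refine ⟨Y - L, ?_⟩
  have hle := im_le_of_le_on_rectangle (G := G) (y := Y - L) (m := m) (M := M) hx hL (hG.mono hsub)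
    hmM
    (fun t ht => (hm1.monotone (by linarith [ht.2])).trans (le_max_left _ _))
    (fun t ht => (hm2.monotone (by linarith [ht.2])).trans (le_max_right _ _))
    (fun s hs => ((hmono s (hI s hs)).monotone (by linarith)).trans (hMs s hs))
    (fun s hs => by rw [sub_add_cancel]; exact hMs s hs) ⟨h1.le, h2.le⟩
  rw [← hk, hkL] at hle
  have hcosh : T ≤ Real.cosh T := (Real.self_le_sinh_iff.mpr hTpos.le).trans (Real.sinh_lt_cosh T).le
  have : 2 * (M - m) / Real.cosh T < c - m := by
    rw [div_lt_iff₀ (Real.cosh_pos T)]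
    have h3 : 2 * (M - m) < (c - m) * T := by
      rw [hT, mul_add, mul_div_cancel₀ _ (by linarith : c - m ≠ 0)]
      linarith
    exact h3.trans_le (mul_le_mul_of_nonneg_left hcosh (by linarith))
  linarith

theorem hasDerivAt_mk_im (x y : ℝ) : HasDerivAt (fun t : ℝ => (⟨x, t⟩ : ℂ)) Complex.I y := by
  have h1 : HasDerivAt (fun t : ℝ => (x : ℂ) + (t : ℂ) * Complex.I) Complex.I y := by
    have := ((Complex.ofRealCLM.hasDerivAt (x := y)).mul_const Complex.I).const_add (x : ℂ)
    simpa using! this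
  have h2 : (fun t : ℝ => (⟨x, t⟩ : ℂ)) = fun t : ℝ => (x : ℂ) + (t : ℂ) * Complex.I := by
    funext s; apply Complex.ext <;> simp
  rw [h2]; exact h1

theorem continuous_mk_re (y : ℝ) : Continuous fun t : ℝ => (⟨t, y⟩ : ℂ) := by
  have h2 : (fun t : ℝ => (⟨t, y⟩ : ℂ)) = fun t : ℝ => (t : ℂ) + (y : ℂ) * Complex.I := by
    funext s; apply Complex.ext <;> simp
  rw [h2]; fun_prop

theorem _root_.HasDerivAt.complexIm {f : ℝ → ℂ} {f' : ℂ} {t : ℝ} (h : HasDerivAt f f' t) :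
    HasDerivAt (fun s => (f s).im) f'.im t :=
  Complex.imCLM.hasFDerivAt.comp_hasDerivAt t h

theorem _root_.HasDerivAt.complexRe {f : ℝ → ℂ} {f' : ℂ} {t : ℝ} (h : HasDerivAt f f' t) :
    HasDerivAt (fun s => (f s).re) f'.re t :=
  Complex.reCLM.hasFDerivAt.comp_hasDerivAt t h

theorem strictMono_im_of_deriv_re_pos {G : ℂ → ℂ} {a b x : ℝ}
    (hG : DifferentiableOn ℂ G (verticalStrip a b))
    (hpos : ∀ w ∈ verticalStrip a b, 0 < (deriv G w).re) (hx : x ∈ Set.Ioo a b) :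
    StrictMono fun y : ℝ => (G ⟨x, y⟩).im := by
  apply strictMono_of_deriv_pos
  intro y
  have hw : (⟨x, y⟩ : ℂ) ∈ verticalStrip a b := hx
  have h1 : HasDerivAt G (deriv G ⟨x, y⟩) ⟨x, y⟩ :=
    (hG.differentiableAt ((isOpen_verticalStrip a b).mem_nhds hw)).hasDerivAt
  have h2 := (h1.comp_of_eq y (hasDerivAt_mk_im x y) rfl).complexIm
  have h3 : deriv (fun y : ℝ => (G ⟨x, y⟩).im) y = (deriv G ⟨x, y⟩ * Complex.I).im := h2.deriv
  rw [h3]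
  simpa using hpos _ hw

/-- If `Re G' > 0` in a vertical strip then the level sets of `Im G` are connected. -/
theorem isPreconnected_level_im {G : ℂ → ℂ} {a b : ℝ}
    (hG : DifferentiableOn ℂ G (verticalStrip a b))
    (hpos : ∀ w ∈ verticalStrip a b, 0 < (deriv G w).re) (c : ℝ) :
    IsPreconnected {w ∈ verticalStrip a b | (G w).im = c} := by
  have hmono : ∀ x ∈ Set.Ioo a b, StrictMono fun y : ℝ => (G ⟨x, y⟩).im := fun x hx =>
    strictMono_im_of_deriv_re_pos hG hpos hx
  have hneg : ∀ w ∈ verticalStrip (-b) (-a), -w ∈ verticalStrip a b := fun w hw =>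
    ⟨by have := hw.2; simp only [Complex.neg_re]; linarith,
     by have := hw.1; simp only [Complex.neg_re]; linarith⟩
  -- The half-turn `w ↦ -G (-w)` preserves monotonicity and exchanges values above `c` with values
  -- below `-c`.
  have hG' : DifferentiableOn ℂ (fun w => -G (-w)) (verticalStrip (-b) (-a)) :=
    (hG.comp differentiable_neg.differentiableOn hneg).neg
  have hmkneg : ∀ x y : ℝ, -(⟨x, y⟩ : ℂ) = ⟨-x, -y⟩ := fun x y => rfl
  have hmono' : ∀ x ∈ Set.Ioo (-b) (-a), StrictMono fun y : ℝ => (-G (-(⟨x, y⟩ : ℂ))).im := by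
    intro x hx y₁ y₂ hy
    have := hmono (-x) ⟨by linarith [hx.2], by linarith [hx.1]⟩ (neg_lt_neg hy)
    simpa [hmkneg] using this
  have hcy : ∀ x ∈ Set.Ioo a b, Continuous fun y : ℝ => (G ⟨x, y⟩).im := by
    intro x hx
    refine Complex.continuous_im.comp (hG.continuousOn.comp_continuous ?_ fun y => hx)
    exact continuous_iff_continuousAt.mpr fun y => (hasDerivAt_mk_im x y).continuousAt
  -- The projection of the level set to the real axis. It is an interval, over which the level set
  -- is the graph of a continuous function.
  set U : Set ℝ := {x | x ∈ Set.Ioo a b ∧ ∃ y : ℝ, (G ⟨x, y⟩).im = c} with hU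
  have hUmem : ∀ x ∈ Set.Ioo a b, (∃ y : ℝ, (G ⟨x, y⟩).im < c) → (∃ y : ℝ, c < (G ⟨x, y⟩).im) →
      x ∈ U := by
    rintro x hx ⟨y₁, h1⟩ ⟨y₂, h2⟩
    exact ⟨hx, mem_range_of_exists_le_of_exists_ge (hcy x hx) ⟨y₁, h1.le⟩ ⟨y₂, h2.le⟩⟩
  have hlt : ∀ x ∈ U, ∃ y : ℝ, (G ⟨x, y⟩).im < c := by
    rintro x ⟨hx, y, hy⟩
    exact ⟨y - 1, hy ▸ hmono x hx (by linarith)⟩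
  have hgt : ∀ x ∈ U, ∃ y : ℝ, c < (G ⟨x, y⟩).im := by
    rintro x ⟨hx, y, hy⟩
    exact ⟨y + 1, hy ▸ hmono x hx (by linarith)⟩
  have hUconn : IsPreconnected U := by
    apply Set.OrdConnected.isPreconnected
    refine ⟨fun x₁ hx₁ x₂ hx₂ x hx => ?_⟩
    rcases hx.1.eq_or_lt with rfl | h1
    · exact hx₁
    rcases hx.2.eq_or_lt with rfl | h2
    · exact hx₂
    have hxI : x ∈ Set.Ioo a b := ⟨hx₁.1.1.trans h1, h2.trans hx₂.1.2⟩
    obtain ⟨y₁, hy₁⟩ := hlt x₁ hx₁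
    obtain ⟨y₂, hy₂⟩ := hlt x₂ hx₂
    obtain ⟨t₁, ht₁⟩ := hgt x₁ hx₁
    obtain ⟨t₂, ht₂⟩ := hgt x₂ hx₂
    refine hUmem x hxI (exists_im_lt_of_strictMono hG hmono hx₁.1.1 h1 h2 hx₂.1.2 hy₁ hy₂) ?_
    obtain ⟨y, hy⟩ := exists_im_lt_of_strictMono (c := -c) hG' hmono' (neg_lt_neg hx₂.1.2)
      (neg_lt_neg h2) (neg_lt_neg h1) (neg_lt_neg hx₁.1.1) (y₁ := -t₂) (y₂ := -t₁)
      (by simpa [hmkneg] using ht₂) (by simpa [hmkneg] using ht₁)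
    exact ⟨-y, by simpa [hmkneg] using hy⟩
  choose! η hη using fun x (hx : x ∈ U) => hx.2
  have hηc : ContinuousOn η U := by
    intro x₀ hx₀
    rw [ContinuousWithinAt, Metric.tendsto_nhds]
    intro ε hε
    have hcx : ∀ y : ℝ, ContinuousAt (fun x : ℝ => (G ⟨x, y⟩).im) x₀ := by
      intro y
      have h1 : ContinuousAt G ⟨x₀, y⟩ :=
        hG.continuousOn.continuousAt ((isOpen_verticalStrip a b).mem_nhds hx₀.1)
      exact Complex.continuous_im.continuousAt.comp
        (ContinuousAt.comp_of_eq h1 (continuous_mk_re y).continuousAt rfl)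
    have hl : (G ⟨x₀, η x₀ - ε⟩).im < c := by
      rw [← hη x₀ hx₀]; exact hmono x₀ hx₀.1 (by linarith)
    have hr : c < (G ⟨x₀, η x₀ + ε⟩).im := by
      rw [← hη x₀ hx₀]; exact hmono x₀ hx₀.1 (by linarith)
    have e1 := ((hcx (η x₀ - ε)).eventually_lt_const hl).filter_mono
      (nhdsWithin_le_nhds (s := U))
    have e2 := ((hcx (η x₀ + ε)).eventually_const_lt hr).filter_mono
      (nhdsWithin_le_nhds (s := U))
    filter_upwards [e1, e2, self_mem_nhdsWithin] with x h1 h2 hxU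
    rw [← hη x hxU] at h1 h2
    have h1' := (hmono x hxU.1).lt_iff_lt.mp h1
    have h2' := (hmono x hxU.1).lt_iff_lt.mp h2
    rw [Real.dist_eq, abs_lt]
    constructor <;> linarith
  have himage : {w ∈ verticalStrip a b | (G w).im = c} = (fun x : ℝ => (⟨x, η x⟩ : ℂ)) '' U := by
    ext w
    constructor
    · rintro ⟨hw, hwc⟩
      have hwU : w.re ∈ U := ⟨hw, w.im, hwc⟩
      refine ⟨w.re, hwU, ?_⟩
      have : η w.re = w.im := (hmono w.re hw).injective ((hη _ hwU).trans hwc.symm)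
      simp only [this]
    · rintro ⟨x, hx, rfl⟩
      exact ⟨hx.1, hη x hx⟩
  rw [himage]
  apply hUconn.image
  have h2 : (fun x : ℝ => (⟨x, η x⟩ : ℂ)) = fun x : ℝ => (x : ℂ) + (η x : ℂ) * Complex.I := by
    funext s; apply Complex.ext <;> simp
  rw [h2]
  exact (Complex.continuous_ofReal.continuousOn).add
    ((Complex.continuous_ofReal.comp_continuousOn hηc).mul continuousOn_const)

/-! ### Univalence and convexity in a direction -/

/-- The Noshiro-Warschawski theorem. -/
theorem injOn_of_deriv_re_pos {G : ℂ → ℂ} {S : Set ℂ} (hS : IsOpen S) (hconv : Convex ℝ S)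
    (hG : DifferentiableOn ℂ G S) (hpos : ∀ w ∈ S, 0 < (deriv G w).re) : Set.InjOn G S := by
  intro w₁ h1 w₂ h2 heq
  by_contra hne
  have hd : w₂ - w₁ ≠ 0 := sub_ne_zero.mpr (Ne.symm hne)
  have hmem : ∀ t ∈ Set.Icc (0 : ℝ) 1, w₁ + (t : ℂ) * (w₂ - w₁) ∈ S := by
    intro t ht
    have := hconv.add_smul_sub_mem h1 h2 ht
    simpa using this
  have hder : ∀ t ∈ Set.Icc (0 : ℝ) 1,
      HasDerivAt (fun t : ℝ => (G (w₁ + (t : ℂ) * (w₂ - w₁)) / (w₂ - w₁)).re)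
        (deriv G (w₁ + (t : ℂ) * (w₂ - w₁))).re t := by
    intro t ht
    have e1 : HasDerivAt (fun t : ℝ => w₁ + (t : ℂ) * (w₂ - w₁)) (w₂ - w₁) t := by
      have := ((Complex.ofRealCLM.hasDerivAt (x := t)).mul_const (w₂ - w₁)).const_add w₁
      simpa using! this
    have e2 := (hG.differentiableAt (hS.mem_nhds (hmem t ht))).hasDerivAt
    have e3 := ((e2.comp_of_eq t e1 rfl).div_const (w₂ - w₁)).complexRe
    rw [mul_div_cancel_right₀ _ hd] at e3
    exact e3
  have hsm := strictMonoOn_of_hasDerivWithinAt_pos (convex_Icc (0 : ℝ) 1)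
    (fun t ht => (hder t ht).continuousAt.continuousWithinAt)
    (fun t ht => (hder t (interior_subset ht)).hasDerivWithinAt)
    (fun t ht => hpos _ (hmem t (interior_subset ht)))
  have := hsm (Set.left_mem_Icc.mpr zero_le_one) (Set.right_mem_Icc.mpr zero_le_one) zero_lt_one
  simp [heq] at this

theorem range_line_eq {u : ℂ} (hu : ‖u‖ = 1) (w : ℂ) :
    (Set.range fun t : ℝ => w + (t : ℂ) * u) = {z | (conj u * z).im = (conj u * w).im} := by
  have huu : conj u * u = 1 := by
    rw [← Complex.normSq_eq_conj_mul_self, Complex.normSq_eq_norm_sq, hu]; simp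
  ext z
  constructor
  · rintro ⟨t, rfl⟩
    have : conj u * (w + t * u) = conj u * w + t := by linear_combination (t : ℂ) * huu
    simp only [Set.mem_ofPred_eq]
    rw [this]; simp
  · intro hz
    simp only [Set.mem_ofPred_eq] at hz
    refine ⟨(conj u * z - conj u * w).re, ?_⟩
    have h1 : (((conj u * z - conj u * w).re : ℝ) : ℂ) = conj u * z - conj u * w := by
      apply Complex.ext
      · simp
      · rw [Complex.ofReal_im, Complex.sub_im, hz, sub_self]
    simp only [h1]
    linear_combination (z - w) * huu

/-- If `Re (e^{-iγ} G') > 0` in a vertical strip, then the image is convex in the direction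
`e^{iγ}`. -/
theorem isPreconnected_image_inter_line {G : ℂ → ℂ} {a b : ℝ} {u : ℂ}
    (hG : DifferentiableOn ℂ G (verticalStrip a b))
    (hpos : ∀ w ∈ verticalStrip a b, 0 < (conj u * deriv G w).re) (w : ℂ) :
    IsPreconnected (G '' verticalStrip a b ∩ {z | (conj u * z).im = (conj u * w).im}) := by
  have hd : ∀ z ∈ verticalStrip a b, deriv (fun z => conj u * G z) z = conj u * deriv G z :=
    fun z hz => deriv_const_mul _
      (hG.differentiableAt ((isOpen_verticalStrip a b).mem_nhds hz))
  have h1 := isPreconnected_level_im (hG.const_mul (conj u))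
    (fun z hz => by rw [hd z hz]; exact hpos z hz) ((conj u * w).im)
  have h2 := h1.image G (hG.continuousOn.mono fun z hz => hz.1)
  convert h2 using 1
  ext z
  constructor
  · rintro ⟨⟨v, hv, rfl⟩, hz⟩
    exact ⟨v, ⟨hv, hz⟩, rfl⟩
  · rintro ⟨v, ⟨hv, hz⟩, rfl⟩
    exact ⟨⟨v, hv, rfl⟩, hz⟩

theorem exp_pi_div_two_cast_mul_I : Complex.exp (((Real.pi / 2 : ℝ) : ℂ) * Complex.I) = Complex.I := by
  push_cast
  exact Complex.exp_pi_div_two_mul_I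

theorem convexInDirection_pi_div_two_iff {Ω : Set ℂ} :
    ConvexInDirection (Real.pi / 2) Ω ↔ ∀ x : ℝ, IsPreconnected (Ω ∩ {z | z.re = x}) := by
  have key : ∀ w : ℂ, (Set.range fun t : ℝ =>
      w + (t : ℂ) * Complex.exp (((Real.pi / 2 : ℝ) : ℂ) * Complex.I)) = {z | z.re = w.re} := by
    intro w
    rw [exp_pi_div_two_cast_mul_I, range_line_eq Complex.norm_I]
    ext z
    simp
  simp only [ConvexInDirection, key]
  exact ⟨fun h x => by simpa using h (x : ℂ), fun h w => h w.re⟩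

/-! ### Shearing along vertical lines -/

/-- The shear construction of Clunie and Sheil-Small in the direction of the imaginary axis. -/
theorem shear {K L : ℂ → ℂ} {E : Set ℂ} (hE : IsOpen E) (hK : DifferentiableOn ℂ K E)
    (hL : DifferentiableOn ℂ L E)
    (hdil : ∀ z ∈ E, deriv K z ≠ 0 ∧ ‖deriv L z / deriv K z‖ < 1)
    (hinj : Set.InjOn (fun z => K z + L z) E)
    (hconv : ConvexInDirection (Real.pi / 2) ((fun z => K z + L z) '' E)) :
    Set.InjOn (harmonicMap K L) E ∧ ConvexInDirection (Real.pi / 2) (harmonicMap K L '' E) := by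
  -- Since `Re f = Re Ψ`, in the coordinate `Ψ` the harmonic map moves points only vertically. On
  -- each vertical slice its imaginary part `q` has derivative `Re ((K' - L') / (K' + L')) = (|K'|²
  -- - |L'|²) / |K' + L'|² > 0`.
  set Ψ : ℂ → ℂ := fun z => K z + L z with hΨ
  have hre : ∀ z, (harmonicMap K L z).re = (Ψ z).re := by simp [harmonicMap, hΨ]
  have him : ∀ z, (harmonicMap K L z).im = (K z - L z).im := by
    simp [harmonicMap, sub_eq_add_neg]
  set χ := Function.invFunOn Ψ E with hχ
  have hχΨ : ∀ z ∈ E, χ (Ψ z) = z := fun z hz => hinj.leftInvOn_invFunOn hz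
  have hχd : ∀ z ∈ E, HasDerivAt χ (deriv K z + deriv L z)⁻¹ (Ψ z) ∧
      0 < ((deriv K z - deriv L z) * (deriv K z + deriv L z)⁻¹).re := by
    intro z hz
    have hKd := hK.differentiableAt (hE.mem_nhds hz)
    have hLd := hL.differentiableAt (hE.mem_nhds hz)
    obtain ⟨hk0, hlt⟩ := hdil z hz
    rw [norm_div, div_lt_one (norm_pos_iff.mpr hk0)] at hlt
    have hsum : deriv K z + deriv L z ≠ 0 := by
      intro h0
      rw [eq_neg_of_add_eq_zero_left h0, norm_neg] at hlt
      exact lt_irrefl _ hlt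
    constructor
    · have han : AnalyticAt ℂ Ψ z := (hK.add hL).analyticAt (hE.mem_nhds hz)
      have hs := han.hasStrictDerivAt
      rw [hΨ, deriv_fun_add hKd hLd] at hs
      exact (hs.to_local_left_inverse hsum
        (by filter_upwards [hE.mem_nhds hz] with v hv using hχΨ v hv)).hasDerivAt
    · rw [← div_eq_mul_inv, Complex.div_re, ← add_div]
      apply div_pos _ (Complex.normSq_pos.mpr hsum)
      have h2 : ‖deriv L z‖ ^ 2 < ‖deriv K z‖ ^ 2 := by gcongr
      rw [← Complex.normSq_eq_norm_sq, ← Complex.normSq_eq_norm_sq, Complex.normSq_apply,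
        Complex.normSq_apply] at h2
      simp only [Complex.sub_re, Complex.add_re, Complex.sub_im, Complex.add_im]
      nlinarith
  set T : ℝ → Set ℝ := fun x => {t | (⟨x, t⟩ : ℂ) ∈ Ψ '' E} with hT
  have hTconn : ∀ x, IsPreconnected (T x) := by
    intro x
    have h1 := ((convexInDirection_pi_div_two_iff.mp hconv) x).image Complex.im
      Complex.continuous_im.continuousOn
    convert h1 using 1
    ext t
    constructor
    · intro ht
      exact ⟨⟨x, t⟩, ⟨ht, rfl⟩, rfl⟩
    · rintro ⟨w, ⟨hw, hwx⟩, rfl⟩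
      have hwx' : w.re = x := hwx
      subst hwx'
      exact hw
  set q : ℝ → ℝ → ℝ := fun x t => (K (χ ⟨x, t⟩) - L (χ ⟨x, t⟩)).im with hq
  have hqd : ∀ x, ∀ t ∈ T x, ∃ d, 0 < d ∧ HasDerivAt (q x) d t := by
    rintro x t ⟨z, hz, hzt⟩
    obtain ⟨h1, h2⟩ := hχd z hz
    rw [hzt] at h1
    have hχz : χ ⟨x, t⟩ = z := by rw [← hzt, hχΨ z hz]
    have h3 := h1.comp_of_eq t (hasDerivAt_mk_im x t) rfl
    have hKL : HasDerivAt (fun z => K z - L z) (deriv K z - deriv L z) z :=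
      (hK.differentiableAt (hE.mem_nhds hz)).hasDerivAt.sub
        (hL.differentiableAt (hE.mem_nhds hz)).hasDerivAt
    have h4 := (hKL.comp_of_eq t h3 hχz.symm).complexIm
    refine ⟨_, ?_, h4⟩
    rw [← mul_assoc]
    simpa using h2
  have hqmono : ∀ x, StrictMonoOn (q x) (T x) := by
    intro x
    have hTc : Convex ℝ (T x) := (hTconn x).ordConnected.convex
    apply strictMonoOn_of_deriv_pos hTc
    · intro t ht
      obtain ⟨d, -, hd⟩ := hqd x t ht
      exact hd.continuousAt.continuousWithinAt
    · intro t ht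
      obtain ⟨d, hd0, hd⟩ := hqd x t (interior_subset ht)
      rwa [hd.deriv]
  have hval : ∀ z ∈ E, harmonicMap K L z = ⟨(Ψ z).re, q (Ψ z).re (Ψ z).im⟩ := by
    intro z hz
    apply Complex.ext
    · exact hre z
    · rw [him, hq]
      simp only
      rw [Complex.eta, hχΨ z hz]
  constructor
  · intro z₁ h1 z₂ h2 heq
    rw [hval z₁ h1, hval z₂ h2] at heq
    obtain ⟨e1, e2⟩ := Complex.mk.inj heq
    rw [e1] at e2
    have m1 : (Ψ z₁).im ∈ T (Ψ z₂).re := ⟨z₁, h1, by rw [← e1, Complex.eta]⟩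
    have m2 : (Ψ z₂).im ∈ T (Ψ z₂).re := ⟨z₂, h2, by rw [Complex.eta]⟩
    exact hinj h1 h2 (Complex.ext e1 ((hqmono _).injOn m1 m2 e2))
  · rw [convexInDirection_pi_div_two_iff]
    intro x
    have h1 : harmonicMap K L '' E ∩ {z | z.re = x} = (fun t : ℝ => (⟨x, q x t⟩ : ℂ)) '' T x := by
      ext w
      constructor
      · rintro ⟨⟨z, hz, rfl⟩, hw⟩
        have hw' : (Ψ z).re = x := by rw [← hre]; exact hw
        refine ⟨(Ψ z).im, ⟨z, hz, by rw [← hw', Complex.eta]⟩, ?_⟩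
        rw [hval z hz, hw']
      · rintro ⟨t, ⟨z, hz, hzt⟩, rfl⟩
        refine ⟨⟨z, hz, ?_⟩, rfl⟩
        rw [hval z hz, hzt]
    rw [h1]
    apply (hTconn x).image
    intro t ht
    obtain ⟨d, -, hd⟩ := hqd x t ht
    have h2 : (fun t : ℝ => (⟨x, q x t⟩ : ℂ)) = fun t : ℝ => (x : ℂ) + (q x t : ℂ) * Complex.I := by
      funext s; apply Complex.ext <;> simp
    rw [h2]
    have h3 : ContinuousAt (fun t : ℝ => (q x t : ℂ)) t :=
      Complex.continuous_ofReal.continuousAt.comp hd.continuousAt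
    exact (continuousAt_const.add (h3.mul continuousAt_const)).continuousWithinAt

/-! ### The conformal map onto the strip -/

/-- If `ζ = (1 + z e^{iθ}) / (1 + z e^{-iθ})`, then `z = (ζ - 1) / (e^{iθ} - ζ e^{-iθ})`. Thus the
condition `|z| < 1` becomes a half-plane condition on `ζ`; the squared moduli differ by `-4 sin θ ·
Im (ζ e^{-iθ})`. -/
theorem norm_sub_one_lt_iff {θ : ℝ} (hθ : 0 < Real.sin θ) (ζ : ℂ) :
    ‖ζ - 1‖ < ‖Complex.exp (θ * Complex.I) - ζ * Complex.exp (-(θ * Complex.I))‖ ↔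
      (ζ * Complex.exp (-(θ * Complex.I))).im < 0 := by
  have hp : Complex.exp (θ * Complex.I) = ⟨Real.cos θ, Real.sin θ⟩ := by
    apply Complex.ext
    · exact Complex.exp_ofReal_mul_I_re θ
    · exact Complex.exp_ofReal_mul_I_im θ
  have hn : Complex.exp (-(θ * Complex.I)) = ⟨Real.cos θ, -Real.sin θ⟩ := by
    rw [← neg_mul, ← Complex.ofReal_neg]
    apply Complex.ext
    · rw [Complex.exp_ofReal_mul_I_re, Real.cos_neg]
    · rw [Complex.exp_ofReal_mul_I_im, Real.sin_neg]
  have hcs := Real.sin_sq_add_cos_sq θ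
  rw [hp, hn, ← sq_lt_sq₀ (norm_nonneg _) (norm_nonneg _), ← Complex.normSq_eq_norm_sq,
    ← Complex.normSq_eq_norm_sq, Complex.normSq_apply, Complex.normSq_apply]
  obtain ⟨x, y⟩ := ζ
  simp only [Complex.sub_re, Complex.sub_im, Complex.one_re, Complex.one_im, Complex.mul_re,
    Complex.mul_im]
  set c := Real.cos θ
  set s := Real.sin θ
  have key : (c - (x * c - y * -s)) * (c - (x * c - y * -s)) +
      (s - (x * -s + y * c)) * (s - (x * -s + y * c)) -
      ((x - 1) * (x - 1) + (y - 0) * (y - 0)) = 4 * s * -(x * -s + y * c) := by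
    linear_combination ((1 - x) ^ 2 + y ^ 2) * hcs
  constructor
  · intro h
    have : 0 < 4 * s * -(x * -s + y * c) := by rw [← key]; linarith
    have := (pos_iff_pos_of_mul_pos this).mp (by positivity)
    linarith
  · intro h
    have : 0 < 4 * s * -(x * -s + y * c) := mul_pos (by positivity) (by linarith)
    linarith

theorem im_exp_mul_exp_neg (s : ℂ) (θ : ℝ) :
    (Complex.exp s * Complex.exp (-(θ * Complex.I))).im = Real.exp s.re * Real.sin (s.im - θ) := by
  rw [← Complex.exp_add, Complex.exp_im]
  simp [sub_eq_add_neg]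

/-- `Z` inverts `F` as a map from the unit disk onto a vertical strip. -/
structure IsStripInverse (F Z : ℂ → ℂ) (a b : ℝ) : Prop where
  differentiableOn : DifferentiableOn ℂ Z (verticalStrip a b)
  mapsTo_inv : ∀ w ∈ verticalStrip a b, Z w ∈ unitDisk
  right_inv : ∀ w ∈ verticalStrip a b, F (Z w) = w
  mapsTo : ∀ z ∈ unitDisk, F z ∈ verticalStrip a b
  left_inv : ∀ z ∈ unitDisk, Z (F z) = z

/-- The half-plane `Im (ζ e^{-iθ}) < 0` is the sector `θ - π < arg ζ < θ`, which avoids the branch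
cut. The principal logarithm maps it onto a horizontal strip, and division by `2i sin θ` makes that
strip vertical. -/
theorem exists_isStripInverse {θ : ℝ} (hθ : θ ∈ Set.Ioo 0 Real.pi) {F : ℂ → ℂ}
    (hF : ∀ z ∈ unitDisk, F z = 1 / (2 * Complex.I * (Real.sin θ : ℂ)) *
        Complex.log ((1 + z * Complex.exp ((θ : ℂ) * Complex.I)) /
          (1 + z * Complex.exp (-((θ : ℂ) * Complex.I))))) :
    ∃ (Z : ℂ → ℂ) (a b : ℝ), IsStripInverse F Z a b := by
  have hsin : 0 < Real.sin θ := Real.sin_pos_of_mem_Ioo hθ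
  set p := Complex.exp ((θ : ℂ) * Complex.I) with hp
  set q := Complex.exp (-((θ : ℂ) * Complex.I)) with hq
  have hpq : p * q = 1 := by rw [hp, hq, ← Complex.exp_add]; simp
  have hpn : ‖p‖ = 1 := Complex.norm_exp_ofReal_mul_I θ
  have hqn : ‖q‖ = 1 := by
    rw [hq, ← neg_mul, ← Complex.ofReal_neg]; exact Complex.norm_exp_ofReal_mul_I _
  set k : ℂ := 2 * Complex.I * (Real.sin θ : ℂ) with hk
  have hk0 : k ≠ 0 :=
    mul_ne_zero (mul_ne_zero two_ne_zero Complex.I_ne_zero) (by exact_mod_cast hsin.ne')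
  have hpmq : p - q ≠ 0 := by
    have : p - q = k := by
      rw [hp, hq, hk, Complex.exp_mul_I, ← neg_mul, Complex.exp_mul_I, Complex.cos_neg,
        Complex.sin_neg, Complex.ofReal_sin]
      ring
    rwa [this]
  have hkim : ∀ w : ℂ, (k * w).im = 2 * Real.sin θ * w.re := by
    intro w
    have : k = ((2 * Real.sin θ : ℝ) : ℂ) * Complex.I := by rw [hk]; push_cast; ring
    rw [this, mul_assoc, Complex.im_ofReal_mul]; simp
  set a : ℝ := (θ - Real.pi) / (2 * Real.sin θ) with ha
  set b : ℝ := θ / (2 * Real.sin θ) with hb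
  have hmem : ∀ w : ℂ, w ∈ verticalStrip a b ↔ θ - Real.pi < (k * w).im ∧ (k * w).im < θ := by
    intro w
    rw [hkim]
    change a < w.re ∧ w.re < b ↔ _
    rw [ha, hb, div_lt_iff₀ (by positivity), lt_div_iff₀ (by positivity), mul_comm w.re]
  set Z : ℂ → ℂ := fun w => (Complex.exp (k * w) - 1) / (p - Complex.exp (k * w) * q) with hZ
  have hlt : ∀ w ∈ verticalStrip a b,
      ‖Complex.exp (k * w) - 1‖ < ‖p - Complex.exp (k * w) * q‖ := by
    intro w hw
    rw [hmem] at hw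
    rw [norm_sub_one_lt_iff hsin, im_exp_mul_exp_neg]
    exact mul_neg_of_pos_of_neg (Real.exp_pos _)
      (Real.sin_neg_of_neg_of_neg_pi_lt (by linarith [hw.2]) (by linarith [hw.1]))
  have hden : ∀ w ∈ verticalStrip a b, p - Complex.exp (k * w) * q ≠ 0 := fun w hw =>
    norm_pos_iff.mp ((norm_nonneg _).trans_lt (hlt w hw))
  have hmaps : ∀ w ∈ verticalStrip a b, Z w ∈ unitDisk := by
    intro w hw
    rw [unitDisk, mem_ball_zero_iff, hZ]
    simp only
    rw [norm_div, div_lt_one (norm_pos_iff.mpr (hden w hw))]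
    exact hlt w hw
  have hone : ∀ z ∈ unitDisk, ∀ r : ℂ, ‖r‖ = 1 → 1 + z * r ≠ 0 := by
    intro z hz r hr h0
    have h1 : z * r = -1 := by linear_combination h0
    have h2 : ‖z * r‖ = 1 := by rw [h1]; simp
    rw [unitDisk, mem_ball_zero_iff] at hz
    rw [norm_mul, hr, mul_one] at h2
    exact hz.ne h2
  have hside : ∀ z ∈ unitDisk, Z (F z) = z ∧ F z ∈ verticalStrip a b := by
    intro z hz
    have hzp := hone z hz p hpn
    have hzq := hone z hz q hqn
    set ζ := (1 + z * p) / (1 + z * q) with hζ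
    have hζ0 : ζ ≠ 0 := div_ne_zero hzp hzq
    have hkF : k * F z = Complex.log ζ := by
      rw [hF z hz, ← mul_assoc, mul_one_div_cancel hk0, one_mul]
    have hexp : Complex.exp (k * F z) = ζ := by rw [hkF, Complex.exp_log hζ0]
    have h1 : ζ - 1 = z * (p - q) / (1 + z * q) := by rw [hζ]; field_simp; ring
    have h2 : p - ζ * q = (p - q) / (1 + z * q) := by
      rw [hζ, eq_div_iff hzq, sub_mul, div_mul_eq_mul_div, div_mul_cancel₀ _ hzq]
      ring
    refine ⟨?_, ?_⟩
    · rw [hZ]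
      simp only
      rw [hexp, h1, h2]
      field_simp
    · rw [hmem, hkF]
      have h3 : (ζ * q).im < 0 := by
        rw [← norm_sub_one_lt_iff hsin, h1, h2, mul_div_assoc, norm_mul]
        rw [unitDisk, mem_ball_zero_iff] at hz
        exact mul_lt_of_lt_one_left (norm_pos_iff.mpr (div_ne_zero hpmq hzq)) hz
      rw [← Complex.exp_log hζ0, im_exp_mul_exp_neg] at h3
      have h4 : Real.sin ((Complex.log ζ).im - θ) < 0 := by
        by_contra hcon
        exact absurd h3 (not_lt.mpr (mul_nonneg (Real.exp_pos _).le (not_lt.mp hcon)))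
      have h5 := Complex.neg_pi_lt_log_im ζ
      have h6 := Complex.log_im_le_pi ζ
      constructor
      -- If `arg ζ ≤ θ - π`, then `arg ζ - θ + 2π` lies in `[0, π]`, where the sine is nonnegative.
      · by_contra hcon
        refine absurd h4 (not_lt.mpr ?_)
        rw [← Real.sin_add_two_pi]
        exact Real.sin_nonneg_of_nonneg_of_le_pi (by linarith [hθ.2]) (by linarith)
      · by_contra hcon
        refine absurd h4 (not_lt.mpr ?_)
        exact Real.sin_nonneg_of_nonneg_of_le_pi (by linarith) (by linarith [hθ.1])
  refine ⟨Z, a, b, ?_, hmaps, ?_, fun z hz => (hside z hz).2, fun z hz => (hside z hz).1⟩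
  · have hE : Differentiable ℂ fun w => Complex.exp (k * w) := by fun_prop
    exact (hE.sub_const 1).differentiableOn.div
      ((hE.mul_const q).const_sub p).differentiableOn hden
  · intro w hw
    rw [hF _ (hmaps w hw)]
    have hd := hden w hw
    have h1 : 1 + Z w * p = Complex.exp (k * w) * (p - q) / (p - Complex.exp (k * w) * q) := by
      rw [hZ]; field_simp; ring
    have h2 : 1 + Z w * q = (p - q) / (p - Complex.exp (k * w) * q) := by
      rw [hZ]; field_simp; ring
    have h3 := (hmem w).mp hw
    rw [h1, h2, mul_div_assoc, mul_div_cancel_right₀ _ (div_ne_zero hpmq hd),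
      Complex.log_exp (by linarith [hθ.1, h3.1]) (by linarith [hθ.2, h3.2]), ← mul_assoc,
      one_div_mul_cancel hk0, one_mul]

/-! ### The analytic combinations `h + c g` -/

/-- In `(conj v * A - v * B) * conj (A + B)` the cross terms are conjugates with opposite signs,
leaving real part `Re v · (|A|² - |B|²)`. -/
theorem mul_re_div_add_pos {v A B : ℂ} (hv : 0 < v.re) (hAB : ‖B‖ < ‖A‖) :
    0 < ((conj v * A - v * B) * (A + B)⁻¹).re := by
  have hsum : A + B ≠ 0 := by
    intro h0
    rw [eq_neg_of_add_eq_zero_left h0, norm_neg] at hAB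
    exact lt_irrefl _ hAB
  rw [← div_eq_mul_inv, Complex.div_re, ← add_div]
  apply div_pos _ (Complex.normSq_pos.mpr hsum)
  have h2 : ‖B‖ ^ 2 < ‖A‖ ^ 2 := by gcongr
  rw [← Complex.normSq_eq_norm_sq, ← Complex.normSq_eq_norm_sq, Complex.normSq_apply,
    Complex.normSq_apply] at h2
  have h3 := mul_pos hv (sub_pos.mpr h2)
  simp only [Complex.sub_re, Complex.add_re, Complex.sub_im, Complex.add_im, Complex.mul_re,
    Complex.mul_im, Complex.conj_re, Complex.conj_im]
  linarith

theorem isOpen_unitDisk : IsOpen unitDisk := Metric.isOpen_ball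

theorem zero_mem_unitDisk : (0 : ℂ) ∈ unitDisk := Metric.mem_ball_self one_pos

theorem DilatationLtOne.norm_lt {h g : ℂ → ℂ} (hdil : DilatationLtOne h g) {z : ℂ}
    (hz : z ∈ unitDisk) : ‖deriv g z‖ < ‖deriv h z‖ := by
  obtain ⟨h0, hlt⟩ := hdil z hz
  rwa [norm_div, div_lt_one (norm_pos_iff.mpr h0)] at hlt

/-- A harmonic map sheared from a vertical strip map is convex: all the analytic functions
`h - e^{2iγ} g` are univalent and convex in the direction `e^{iγ}`. -/
theorem univalent_convexInDirection_of_isStripInverse {h g Z : ℂ → ℂ} {a b : ℝ}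
    (hh : DifferentiableOn ℂ h unitDisk) (hg : DifferentiableOn ℂ g unitDisk)
    (hdil : DilatationLtOne h g) (hZ : IsStripInverse (fun z => h z + g z) Z a b) {γ : ℝ}
    {c : ℂ} (hc : c = -Complex.exp ((γ : ℂ) * Complex.I) ^ 2) :
    Set.InjOn (fun z => h z + c * g z) unitDisk ∧
      ConvexInDirection γ ((fun z => h z + c * g z) '' unitDisk) := by
  set u := Complex.exp ((γ : ℂ) * Complex.I) with hu
  have hun : ‖u‖ = 1 := Complex.norm_exp_ofReal_mul_I γ
  set ψ : ℂ → ℂ := fun z => h z + c * g z with hψ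
  set S := verticalStrip a b with hS
  set G : ℂ → ℂ := fun w => ψ (Z w) with hG
  have hψG : ∀ z ∈ unitDisk, ψ z = G (h z + g z) := fun z hz => by
    rw [hG]; simp only; rw [hZ.left_inv z hz]
  have himg : ψ '' unitDisk = G '' S := by
    ext w
    constructor
    · rintro ⟨z, hz, rfl⟩
      exact ⟨_, hZ.mapsTo z hz, (hψG z hz).symm⟩
    · rintro ⟨v, hv, rfl⟩
      exact ⟨Z v, hZ.mapsTo_inv v hv, rfl⟩
  have hinj_of : Set.InjOn G S → Set.InjOn ψ unitDisk := by
    intro hi z₁ h1 z₂ h2 heq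
    rw [hψG z₁ h1, hψG z₂ h2] at heq
    have := hi (hZ.mapsTo z₁ h1) (hZ.mapsTo z₂ h2) heq
    rw [← hZ.left_inv z₁ h1, ← hZ.left_inv z₂ h2]
    exact congrArg Z this
  have hZd : ∀ w ∈ S, HasDerivAt Z (deriv Z w) w := fun w hw =>
    (hZ.differentiableOn.differentiableAt ((isOpen_verticalStrip a b).mem_nhds hw)).hasDerivAt
  have hhd : ∀ z ∈ unitDisk, HasDerivAt h (deriv h z) z := fun z hz =>
    (hh.differentiableAt (isOpen_unitDisk.mem_nhds hz)).hasDerivAt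
  have hgd : ∀ z ∈ unitDisk, HasDerivAt g (deriv g z) z := fun z hz =>
    (hg.differentiableAt (isOpen_unitDisk.mem_nhds hz)).hasDerivAt
  have hGd : ∀ w ∈ S, HasDerivAt G ((deriv h (Z w) + c * deriv g (Z w)) * deriv Z w) w := by
    intro w hw
    have hz := hZ.mapsTo_inv w hw
    exact ((hhd _ hz).add ((hgd _ hz).const_mul c)).comp w (hZd w hw)
  have hZinv : ∀ w ∈ S, deriv Z w = (deriv h (Z w) + deriv g (Z w))⁻¹ := by
    intro w hw
    have hz := hZ.mapsTo_inv w hw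
    have h1 : HasDerivAt (fun w => h (Z w) + g (Z w))
        ((deriv h (Z w) + deriv g (Z w)) * deriv Z w) w :=
      ((hhd _ hz).add (hgd _ hz)).comp w (hZd w hw)
    have h2 : HasDerivAt (fun w => h (Z w) + g (Z w)) 1 w :=
      (hasDerivAt_id w).congr_of_eventuallyEq (by
        filter_upwards [(isOpen_verticalStrip a b).mem_nhds hw] with v hv
        exact hZ.right_inv v hv)
    exact eq_inv_of_mul_eq_one_right (h1.unique h2)
  have hGdiff : DifferentiableOn ℂ G S := fun w hw =>
    (hGd w hw).differentiableAt.differentiableWithinAt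
  -- For the vertical direction the real part vanishes identically, but then `c = 1` and `G` is the
  -- identity of the strip.
  by_cases hre : u.re = 0
  · have hc1 : c = 1 := by
      have h1 : u ^ 2 = -1 := by
        have h2 : u.im ^ 2 = 1 := by
          have := Complex.normSq_eq_norm_sq u
          rw [hun, Complex.normSq_apply, hre] at this
          linarith
        have h3 : u = (u.im : ℂ) * Complex.I := by
          apply Complex.ext <;> simp [hre]
        rw [h3, mul_pow, Complex.I_sq, ← Complex.ofReal_pow, h2]
        simp
      rw [hc, h1, neg_neg]
    have hGid : ∀ w ∈ S, G w = w := fun w hw => by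
      rw [hG, hψ, hc1]; simp only [one_mul]; exact hZ.right_inv w hw
    refine ⟨hinj_of fun w₁ h1 w₂ h2 heq => ?_, ?_⟩
    · rwa [hGid w₁ h1, hGid w₂ h2] at heq
    · have : G '' S = S := by rw [Set.image_congr hGid, Set.image_id']
      rw [himg, this]
      intro w
      apply Convex.isPreconnected
      apply (convex_verticalStrip a b).inter
      rw [← Set.image_univ]
      rintro _ ⟨s, -, rfl⟩ _ ⟨t, -, rfl⟩ α β - - hαβ
      refine ⟨α * s + β * t, trivial, ?_⟩
      have : (α : ℂ) + β = 1 := by exact_mod_cast hαβ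
      simp only [Complex.real_smul]
      push_cast
      linear_combination (-w) * this
  -- Replacing `u` by `-u` changes neither `u ^ 2` nor the family of lines, so `Re v > 0` may be
  -- assumed.
  · obtain ⟨v, hv0, hvn, hvu, hline⟩ : ∃ v : ℂ, 0 < v.re ∧ ‖v‖ = 1 ∧ v ^ 2 = u ^ 2 ∧
        ∀ w : ℂ, {z : ℂ | (conj u * z).im = (conj u * w).im} =
          {z | (conj v * z).im = (conj v * w).im} := by
      rcases lt_or_gt_of_ne hre with hneg | hpos
      · refine ⟨-u, by simpa using hneg, by simpa using hun, by ring, fun w => ?_⟩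
        ext z
        simp only [Set.mem_ofPred_eq, map_neg, neg_mul, Complex.neg_im, neg_inj]
      · exact ⟨u, hpos, hun, rfl, fun w => rfl⟩
    have hvv : conj v * v = 1 := by
      rw [← Complex.normSq_eq_conj_mul_self, Complex.normSq_eq_norm_sq, hvn]; simp
    have hpos : ∀ w ∈ S, 0 < (conj v * deriv G w).re := by
      intro w hw
      rw [(hGd w hw).deriv, hZinv w hw, hc, ← hvu]
      have := mul_re_div_add_pos hv0 (hdil.norm_lt (hZ.mapsTo_inv w hw))
      convert this using 2
      linear_combination (-v * deriv g (Z w) * (deriv h (Z w) + deriv g (Z w))⁻¹) * hvv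
    refine ⟨hinj_of ?_, ?_⟩
    · have hd : ∀ z ∈ S, deriv (fun z => conj v * G z) z = conj v * deriv G z := fun z hz =>
        deriv_const_mul _ (hGd z hz).differentiableAt
      have hi := injOn_of_deriv_re_pos (isOpen_verticalStrip a b) (convex_verticalStrip a b)
        (hGdiff.const_mul (conj v)) (fun z hz => by rw [hd z hz]; exact hpos z hz)
      intro w₁ h1 w₂ h2 heq
      exact hi h1 h2 (congrArg (fun x => conj v * x) heq)
    · intro w
      rw [himg, range_line_eq hun, hline]
      exact isPreconnected_image_inter_line hGdiff hpos w

/-! ### Linearity of the convolution -/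

theorem hadamard_zero (f g : ℂ → ℂ) : hadamard f g 0 = f 0 * g 0 := by
  rw [hadamard, tsum_eq_single 0 fun n hn => by simp [hn]]
  simp [taylorCoeff]

theorem taylorCoeff_add_const_mul {f g : ℂ → ℂ} (hf : DifferentiableOn ℂ f unitDisk)
    (hg : DifferentiableOn ℂ g unitDisk) (c : ℂ) (n : ℕ) :
    taylorCoeff (fun z => f z + c * g z) n = taylorCoeff f n + c * taylorCoeff g n := by
  have h0 : unitDisk ∈ 𝓝 (0 : ℂ) := isOpen_unitDisk.mem_nhds zero_mem_unitDisk
  have hfc : ContDiffAt ℂ n f 0 := (hf.analyticAt h0).contDiffAt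
  have hgc : ContDiffAt ℂ n (fun z => c * g z) 0 := ((hg.const_mul c).analyticAt h0).contDiffAt
  rw [taylorCoeff, iteratedDeriv_fun_add hfc hgc, iteratedDeriv_const_mul_field, taylorCoeff,
    taylorCoeff]
  ring

theorem summable_taylorCoeff_mul_pow {f : ℂ → ℂ} (hf : DifferentiableOn ℂ f unitDisk) {z : ℂ}
    (hz : z ∈ unitDisk) : Summable fun n => taylorCoeff f n * z ^ n := by
  refine (Complex.hasSum_taylorSeries_on_ball hf hz).summable.congr fun n => ?_
  simp only [taylorCoeff, smul_eq_mul, sub_zero]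
  ring

theorem summable_hadamard {f g : ℂ → ℂ} (hf : DifferentiableOn ℂ f unitDisk)
    (hg : DifferentiableOn ℂ g unitDisk) {z : ℂ} (hz : z ∈ unitDisk) :
    Summable fun n => taylorCoeff f n * taylorCoeff g n * z ^ n := by
  have hz1 : ‖z‖ < 1 := mem_ball_zero_iff.mp hz
  -- Both Taylor series converge absolutely at `√|z| < 1`; the convolution series is dominated by
  -- the diagonal of their product.
  set s : ℂ := ((Real.sqrt ‖z‖ : ℝ) : ℂ)
  have hsn : ‖s‖ = Real.sqrt ‖z‖ := by
    rw [Complex.norm_real, Real.norm_of_nonneg (Real.sqrt_nonneg _)]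
  have hs : s ∈ unitDisk := by
    rw [unitDisk, mem_ball_zero_iff, hsn, Real.sqrt_lt' one_pos]
    simpa using hz1
  have h1 := (summable_taylorCoeff_mul_pow hf hs).norm
  have h2 := (summable_taylorCoeff_mul_pow hg hs).norm
  refine Summable.of_norm ((Summable.mul_of_nonneg h1 h2 (fun _ => norm_nonneg _)
    (fun _ => norm_nonneg _)).comp_injective (i := fun n : ℕ => (n, n))
    (fun a b hab => congrArg Prod.fst hab) |>.congr fun n => ?_)
  simp only [Function.comp_apply, norm_mul, norm_pow, hsn]
  have h3 : Real.sqrt ‖z‖ ^ n * Real.sqrt ‖z‖ ^ n = ‖z‖ ^ n := by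
    rw [← mul_pow, Real.mul_self_sqrt (norm_nonneg _)]
  linear_combination (‖taylorCoeff f n‖ * ‖taylorCoeff g n‖) * h3

theorem hadamard_add_const_mul {φ f g : ℂ → ℂ} (hφ : DifferentiableOn ℂ φ unitDisk)
    (hf : DifferentiableOn ℂ f unitDisk) (hg : DifferentiableOn ℂ g unitDisk) (c : ℂ) {z : ℂ}
    (hz : z ∈ unitDisk) :
    hadamard φ (fun z => f z + c * g z) z = hadamard f φ z + c * hadamard g φ z := by
  simp only [hadamard]
  rw [← tsum_mul_left, ← (summable_hadamard hf hφ hz).tsum_add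
    ((summable_hadamard hg hφ hz).mul_left c)]
  refine tsum_congr fun n => ?_
  rw [taylorCoeff_add_const_mul hf hg]
  ring

/-! ### Normalization, dilatation and conclusion -/

/-- Take `γ` to be half the argument of `-c`, adding `π` when it is negative; this does not affect
the square. -/
theorem exists_eq_neg_exp_sq {c : ℂ} (hc : ‖c‖ = 1) :
    ∃ γ ∈ Set.Ico (0 : ℝ) Real.pi, c = -Complex.exp ((γ : ℂ) * Complex.I) ^ 2 := by
  have h1 : -c = Complex.exp (((-c).arg : ℂ) * Complex.I) := by
    have := Complex.norm_mul_exp_arg_mul_I (-c)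
    rw [norm_neg, hc] at this
    simpa using this.symm
  have hpi := Real.pi_pos
  have hlo := Complex.neg_pi_lt_arg (-c)
  have hhi := Complex.arg_le_pi (-c)
  rcases le_or_gt 0 (-c).arg with h0 | h0
  · refine ⟨(-c).arg / 2, ⟨by linarith, by linarith⟩, ?_⟩
    rw [← Complex.exp_nat_mul, ← neg_eq_iff_eq_neg]
    conv_lhs => rw [h1]
    congr 1
    push_cast
    ring
  · refine ⟨(-c).arg / 2 + Real.pi, ⟨by linarith, by linarith⟩, ?_⟩
    rw [← Complex.exp_nat_mul, ← neg_eq_iff_eq_neg]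
    conv_lhs => rw [h1, ← Complex.exp_periodic]
    congr 1
    push_cast
    ring

theorem hasDerivAt_stripMap_zero {θ : ℝ} (hθ : Real.sin θ ≠ 0) :
    HasDerivAt (fun z : ℂ => 1 / (2 * Complex.I * (Real.sin θ : ℂ)) *
        Complex.log ((1 + z * Complex.exp ((θ : ℂ) * Complex.I)) /
          (1 + z * Complex.exp (-((θ : ℂ) * Complex.I))))) 1 0 := by
  have hpq : Complex.exp ((θ : ℂ) * Complex.I) - Complex.exp (-((θ : ℂ) * Complex.I)) =
      2 * Complex.I * (Real.sin θ : ℂ) := by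
    rw [Complex.exp_mul_I, ← neg_mul, Complex.exp_mul_I, Complex.cos_neg,
      Complex.sin_neg, Complex.ofReal_sin]
    ring
  set p := Complex.exp ((θ : ℂ) * Complex.I)
  set q := Complex.exp (-((θ : ℂ) * Complex.I))
  have hk0 : 2 * Complex.I * (Real.sin θ : ℂ) ≠ 0 :=
    mul_ne_zero (mul_ne_zero two_ne_zero Complex.I_ne_zero) (by exact_mod_cast hθ)
  have hlin : ∀ r : ℂ, HasDerivAt (fun z : ℂ => 1 + z * r) r 0 := fun r => by
    simpa using! ((hasDerivAt_id (0 : ℂ)).mul_const r).const_add 1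
  have h1 := ((hlin p).div (hlin q) (by simp)).clog (by simp)
  have h2 := h1.const_mul (1 / (2 * Complex.I * (Real.sin θ : ℂ)))
  refine h2.congr_deriv ?_
  simp only [Pi.div_apply, zero_mul, add_zero, mul_one, one_mul, div_one, one_pow, hpq]
  exact one_div_mul_cancel hk0

/-- If no combination `K + cL` with `|c| = 1` has a critical point in the disk, then the dilatation
`L' / K'` stays below one in modulus as soon as it does so at the origin. -/
theorem dilatationLtOne_of_deriv_ne_zero {K L : ℂ → ℂ} (hK : DifferentiableOn ℂ K unitDisk)
    (hL : DifferentiableOn ℂ L unitDisk) (h0 : ‖deriv L 0‖ < ‖deriv K 0‖)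
    (hne : ∀ c : ℂ, ‖c‖ = 1 → ∀ z ∈ unitDisk, deriv K z + c * deriv L z ≠ 0) :
    DilatationLtOne K L := by
  have hKc : ContinuousOn (fun z => ‖deriv K z‖) unitDisk :=
    (hK.deriv isOpen_unitDisk).continuousOn.norm
  have hLc : ContinuousOn (fun z => ‖deriv L z‖) unitDisk :=
    (hL.deriv isOpen_unitDisk).continuousOn.norm
  have hlt : ∀ z ∈ unitDisk, ‖deriv L z‖ < ‖deriv K z‖ := by
    intro z hz
    by_contra hcon
    -- At a point where the moduli agree, `c = -K' / L'` gives a critical point of `K + c L`; if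
    -- both derivatives vanish there, `c = 1` does.
    obtain ⟨v, hv, hveq⟩ := (convex_ball (0 : ℂ) 1).isPreconnected.intermediate_value₂
      zero_mem_unitDisk hz hLc hKc h0.le (not_lt.mp hcon)
    by_cases hL0 : deriv L v = 0
    · have hK0 : deriv K v = 0 := by rw [← norm_eq_zero, ← hveq, hL0, norm_zero]
      exact hne 1 norm_one v hv (by rw [hL0, hK0]; simp)
    · refine hne (-(deriv K v / deriv L v)) ?_ v hv ?_
      · rw [norm_neg, norm_div, ← hveq, div_self (norm_ne_zero_iff.mpr hL0)]
      · rw [neg_mul, div_mul_cancel₀ _ hL0, add_neg_cancel]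
  intro z hz
  have hpos : 0 < ‖deriv K z‖ := (norm_nonneg _).trans_lt (hlt z hz)
  exact ⟨norm_pos_iff.mp hpos, by rw [norm_div, div_lt_one hpos]; exact hlt z hz⟩

end HarmonicConvolution

open HarmonicConvolution in
theorem corollary3p3 (θ : ℝ) (hθ : θ ∈ Set.Ioo (0 : ℝ) Real.pi) (h g : ℂ → ℂ)
    (hnorm : HarmonicConvolution.IsNormalizedPair h g)
    (hsum : ∀ z ∈ HarmonicConvolution.unitDisk,
      h z + g z = 1 / (2 * Complex.I * (Real.sin θ : ℂ)) *
        Complex.log ((1 + z * Complex.exp ((θ : ℂ) * Complex.I)) /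
          (1 + z * Complex.exp (-((θ : ℂ) * Complex.I)))))
    (hdil : HarmonicConvolution.DilatationLtOne h g)
    (φ : ℂ → ℂ) (hφ : φ ∈ HarmonicConvolution.classDCP) :
    HarmonicConvolution.harmonicConv h g φ ∈ HarmonicConvolution.classKH (Real.pi / 2) := by
  obtain ⟨hφd, hφK⟩ := hφ
  obtain ⟨hh, hg, hh0, hg0, hh1⟩ := hnorm
  have hE0 : unitDisk ∈ nhds (0 : ℂ) := isOpen_unitDisk.mem_nhds zero_mem_unitDisk
  -- The strip map has derivative `1` at the origin, as does `h`. Hence `g'(0) = 0`, and every `h +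
  -- c g` is normalized.
  have hg1 : deriv g 0 = 0 := by
    have h1 : HasDerivAt (fun z => h z + g z) 1 0 :=
      (hasDerivAt_stripMap_zero (Real.sin_pos_of_mem_Ioo hθ).ne').congr_of_eventuallyEq (by
        filter_upwards [hE0] with z hz using hsum z hz)
    have h2 := (hh.differentiableAt hE0).hasDerivAt.add (hg.differentiableAt hE0).hasDerivAt
    have h3 := h2.unique h1
    rw [hh1] at h3
    linear_combination h3
  obtain ⟨Z, a, b, hZ⟩ := exists_isStripInverse hθ hsum
  set K := hadamard h φ with hK
  set L := hadamard g φ with hL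
  have hKL : ∀ γ ∈ Set.Ico (0 : ℝ) Real.pi, ∀ c : ℂ,
      c = -Complex.exp ((γ : ℂ) * Complex.I) ^ 2 →
      DifferentiableOn ℂ (fun z => K z + c * L z) unitDisk ∧
      deriv (fun z => K z + c * L z) 0 = 1 ∧ Set.InjOn (fun z => K z + c * L z) unitDisk ∧
      ConvexInDirection γ ((fun z => K z + c * L z) '' unitDisk) := by
    intro γ hγ c hc
    obtain ⟨hi, hcv⟩ := univalent_convexInDirection_of_isStripInverse hh hg hdil hZ hc
    have hmem : (fun z => h z + c * g z) ∈ classK γ := by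
      refine ⟨⟨hh.add (hg.const_mul c), by simp [hh0, hg0], ?_, hi⟩, hcv⟩
      have := (hh.differentiableAt hE0).hasDerivAt.add
        ((hg.differentiableAt hE0).hasDerivAt.const_mul c)
      have h2 := this.deriv
      rw [hh1, hg1, mul_zero, add_zero] at h2
      exact h2
    have heq : Set.EqOn (hadamard φ (fun z => h z + c * g z)) (fun z => K z + c * L z) unitDisk :=
      fun z hz => hadamard_add_const_mul hφd hh hg c hz
    obtain ⟨⟨h1, -, h3, h4⟩, h5⟩ := hφK γ hγ _ hmem
    refine ⟨h1.congr fun z hz => (heq hz).symm, ?_, h4.congr heq, ?_⟩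
    · rw [← h3]
      exact (heq.eventuallyEq_of_mem hE0).deriv_eq.symm
    · rwa [heq.image_eq] at h5
  have hKLc : ∀ c : ℂ, ‖c‖ = 1 → DifferentiableOn ℂ (fun z => K z + c * L z) unitDisk ∧
      deriv (fun z => K z + c * L z) 0 = 1 ∧ Set.InjOn (fun z => K z + c * L z) unitDisk := by
    intro c hc
    obtain ⟨γ, hγ, hcγ⟩ := exists_eq_neg_exp_sq hc
    obtain ⟨h1, h2, h3, -⟩ := hKL γ hγ c hcγ
    exact ⟨h1, h2, h3⟩
  obtain ⟨hp1, hp2, -⟩ := hKLc 1 norm_one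
  obtain ⟨hm1, hm2, -⟩ := hKLc (-1) (by simp)
  -- Analyticity of `K` and `L` is read off from `K + L` and `K - L`, which lie in classes `K_γ`.
  have hKd : DifferentiableOn ℂ K unitDisk :=
    ((hp1.add hm1).const_mul (1 / 2)).congr fun z _ => by simp only [Pi.add_apply]; ring
  have hLd : DifferentiableOn ℂ L unitDisk :=
    ((hp1.sub hm1).const_mul (1 / 2)).congr fun z _ => by simp only [Pi.sub_apply]; ring
  have hder : ∀ (c : ℂ), ∀ z ∈ unitDisk,
      deriv (fun z => K z + c * L z) z = deriv K z + c * deriv L z := fun c z hz =>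
    ((hKd.differentiableAt (isOpen_unitDisk.mem_nhds hz)).hasDerivAt.add
      ((hLd.differentiableAt (isOpen_unitDisk.mem_nhds hz)).hasDerivAt.const_mul c)).deriv
  rw [hder _ 0 zero_mem_unitDisk] at hp2 hm2
  have hK1 : deriv K 0 = 1 := by linear_combination (hp2 + hm2) / 2
  have hL1 : deriv L 0 = 0 := by linear_combination (hp2 - hm2) / 2
  have hdilKL : DilatationLtOne K L := by
    refine dilatationLtOne_of_deriv_ne_zero hKd hLd (by rw [hK1, hL1]; simp) fun c hc z hz => ?_
    obtain ⟨h1, -, h3⟩ := hKLc c hc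
    have hz' := isOpen_unitDisk.mem_nhds hz
    rw [← hder c z hz]
    exact deriv_ne_zero_of_injOn hz' (h1.analyticAt hz') h3
  obtain ⟨-, -, hinj, hcv⟩ := hKL (Real.pi / 2)
    ⟨by linarith [Real.pi_pos], by linarith [Real.pi_pos]⟩ 1
    (by rw [exp_pi_div_two_cast_mul_I, Complex.I_sq, neg_neg])
  simp only [one_mul] at hinj hcv
  obtain ⟨hfi, hfc⟩ := shear isOpen_unitDisk hKd hLd hdilKL hinj hcv
  refine ⟨⟨K, L, ⟨hKd, hLd, ?_, ?_, hK1⟩, hdilKL, fun z _ => rfl, hfi⟩, hfc⟩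
  · rw [hK, hadamard_zero, hh0, zero_mul]
  · rw [hL, hadamard_zero, hg0, zero_mul]
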